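/- Let $\omega=e^{i\pi/4}$ and $R=\mathbb{Z}[i,1/\sqrt2]\subset\mathbb{C}$. For $x,y\in\mathbb{C}$ and $k\in\mathbb{Z}$ put $$U[x,y,k]=\begin{pmatrix} x & -y^{*}\omega^{k}\\ y & x^{*}\omega^{k}\end{pmatrix},$$ and call $U[x,y,k]$ an exact unitary if $x,y\in R$ and the matrix is unitary. The T-count $T(V)\in\mathbb{N}\cup\{\infty\}$ of a single-qubit unitary $V$ is the least $n$ such that $V=e^{i\alpha}C_1TC_2T\cdots C_nTC_{n+1}$ for some real $\alpha$ and single-qubit Clifford unitaries $C_j$ (finite products of the gates $X$, $Y$, $Z$, $H$ and $P=T^2$), where $T=\mathrm{diag}(1,\omega)$; it is $\infty$ if no such $n$ exists. For $x\in R$ and $k\in\mathbb{Z}$ let $$T_k(x)=\min\{\,T(U[x,y,k]) : U[x,y,k]\text{ is an exact unitary}\,\},$$ with $T_k(x)=\infty$ if this set is empty. An exact unitary $U[x,y,k]$ is called minimal if its T-count is the minimum of the T-counts of all exact unitaries $U[x,y',k]$ with $y'\in R$. For a real number $z$, the smallest denominator exponent $\mathrm{sde}(z)$ is the least integer $m$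 such that $z=(a+\sqrt2\,b)/\sqrt2^{\,m}$ for some integers $a,b$, if such a least integer exists. Proposition. For all $x\in R$ and $k\in\mathbb{Z}$: 1. every minimal unitary $U[x,y,k]$ has T-count $T_k(x)$; 2. $T_k(x)=T_{k\bmod 2}(x)$; 3. $T_k(x)=T_k(\omega x)$; 4. if $4\le T_k(x)<\infty$, then $\mathrm{sde}(|x|^2)$ exists and $T_k(x)=\mathrm{sde}(|x|^2)-2+\big((\mathrm{sde}(|x|^2)+k)\bmod 2\big)$, where $\bmod\ 2$ takes values in $\{0,1\}$. -/

import Mathlib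

open scoped Matrix

namespace CliffordT

noncomputable section

/-- The eighth root of unity `ω = e^{iπ/4}`. -/
def omega : ℂ := Complex.exp (Complex.I * (Real.pi : ℂ) / 4)

/-- The ring `ℤ[i, 1/√2]`, as a subring of the complex numbers. -/
def ringZf : Subring ℂ := Subring.closure {Complex.I, 1 / ((Real.sqrt 2 : ℝ) : ℂ)}

/-- The matrix `U[x,y,k]`. -/
def U (x y : ℂ) (k : ℤ) : Matrix (Fin 2) (Fin 2) ℂ :=
  !![x, -(starRingEnd ℂ y) * omega ^ k; y, starRingEnd ℂ x * omega ^ k]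

/-- The Pauli gate `X`. -/
def gateX : Matrix (Fin 2) (Fin 2) ℂ := !![0, 1; 1, 0]

/-- The Pauli gate `Z`. -/
def gateZ : Matrix (Fin 2) (Fin 2) ℂ := !![1, 0; 0, -1]

/-- The Pauli gate `Y = iXZ`. -/
def gateY : Matrix (Fin 2) (Fin 2) ℂ := Complex.I • (gateX * gateZ)

/-- The Hadamard gate `H`. -/
def gateH : Matrix (Fin 2) (Fin 2) ℂ :=
  (1 / ((Real.sqrt 2 : ℝ) : ℂ)) • !![1, 1; 1, -1]

/-- The `T` gate. -/
def gateT : Matrix (Fin 2) (Fin 2) ℂ := !![1, 0; 0, omega]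

/-- The Phase gate `P = T²`. -/
def gateP : Matrix (Fin 2) (Fin 2) ℂ := gateT ^ 2

/-- Single-qubit Clifford unitaries: finite products of the gates `X, Y, Z, H, P`.
Each of these gates has finite order, so the monoid they generate is a group. -/
def cliffords : Submonoid (Matrix (Fin 2) (Fin 2) ℂ) :=
  Submonoid.closure {gateX, gateY, gateZ, gateH, gateP}

/-- `CircuitWith n W`: the matrix `W` has the form `C₁ T C₂ T ⋯ Cₙ T Cₙ₊₁`
with `n` gates `T` and Clifford unitaries `C₁, …, Cₙ₊₁`. -/
inductive CircuitWith : ℕ → Matrix (Fin 2) (Fin 2) ℂ → Prop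
  | clifford (C : Matrix (Fin 2) (Fin 2) ℂ) (hC : C ∈ cliffords) : CircuitWith 0 C
  | step (n : ℕ) (C W : Matrix (Fin 2) (Fin 2) ℂ) (hC : C ∈ cliffords)
      (hW : CircuitWith n W) : CircuitWith (n + 1) (C * gateT * W)

/-- The T-count of a single-qubit unitary: the least number of `T` gates of a Clifford+T
circuit that implements `V` up to a global phase `e^{iα}` (`⊤` if there is no such circuit). -/
def tCount (V : Matrix (Fin 2) (Fin 2) ℂ) : ℕ∞ :=
  sInf {t : ℕ∞ | ∃ n : ℕ, t = (n : ℕ∞) ∧ ∃ (α : ℝ) (W : Matrix (Fin 2) (Fin 2) ℂ),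
    CircuitWith n W ∧ V = Complex.exp (Complex.I * (α : ℂ)) • W}

/-- `U[x,y,k]` is an exact unitary: `x, y ∈ ℤ[i, 1/√2]` and the matrix is unitary. -/
def IsExact (x y : ℂ) (k : ℤ) : Prop :=
  x ∈ ringZf ∧ y ∈ ringZf ∧ U x y k ∈ Matrix.unitaryGroup (Fin 2) ℂ

/-- The set of T-counts of all exact unitaries `U[x,y',k]` with the given `x` and `k`. -/
def tCounts (k : ℤ) (x : ℂ) : Set ℕ∞ :=
  {t | ∃ y' : ℂ, IsExact x y' k ∧ t = tCount (U x y' k)}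

/-- The exact unitary `U[x,y,k]` is minimal: its T-count is the minimum of the T-counts
of all exact unitaries `U[x,y',k]`. -/
def IsMinimal (x y : ℂ) (k : ℤ) : Prop :=
  IsExact x y k ∧ IsLeast (tCounts k x) (tCount (U x y k))

/-- The T-count `T_k(x)` of a ring element: the minimum of the T-counts of all exact unitaries
`U[x,y,k]`, which is `⊤` if there are none. -/
def tCountElem (k : ℤ) (x : ℂ) : ℕ∞ := sInf (tCounts k x)

/-- The exponents `m` for which `z` can be written as `(a + √2 b) / √2 ^ m`, with integers
`a, b, m`. -/
def denExponents (z : ℝ) : Set ℤ :=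
  {m : ℤ | ∃ a b : ℤ, z = ((a : ℝ) + Real.sqrt 2 * (b : ℝ)) / Real.sqrt 2 ^ m}

/-- `IsSde z m`: the smallest denominator exponent `sde z` exists and equals `m`. -/
def IsSde (z : ℝ) (m : ℤ) : Prop := IsLeast (denExponents z) m

end

end CliffordT

namespace CliffordT

/-! ### The eighth root of unity and the ring `ℤ[i, 1/√2]` -/

/-! The first claim is the definition of a minimum. The second and third hold because the changes of
`k` and `x` multiply U[x,y,k] by Clifford gates and phases: U[x,y,k+2j] = U[x,y,k] · diag(1, i^j),
and U[ωx, ω⁻¹y, k] = ω · diag(1, ω⁻²) · U[x,y,k].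

For the fourth, let U[x,y,k] attain n = T_k(x). Every Clifford+T circuit is monomial or of the form
d V d', with d, d' monomial and V = H d₁ H ⋯ dₘ H, all dⱼ of odd exponent
(`CircuitWith.hasNormalForm`). The monomial case needs at most one T gate. Otherwise three facts
determine n.

Denominators: the (0,0) entry of U Z U† is 2|x|² − 1. Following the Bloch vector modulo √2 along the
core shows that √2^m (2|x|² − 1) is a unit modulo √2 (`Core.exists_hasBlochVec`), so sde(|x|²) = m +
2. A circuit with n T gates only produces denominators dividing √2^n (`CircuitWith.hasBlochVec`), so
m ≤ n.

Freedom in y: replacing y by ω^j y conjugates U by diag(1, ω^j). A suitable j makes the right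
monomial factor Clifford up to phase, and the left one costs at most one T, so n ≤ m + 1
(`tCountElem_le_of_core`).

Parity: determinants force n ≡ k mod 2, because ω is not a square in the ring
(`even_sub_of_phaseCircuit`). This selects between m and m + 1. -/

theorem sqrt_two_mul_self : ((Real.sqrt 2 : ℝ) : ℂ) * ((Real.sqrt 2 : ℝ) : ℂ) = 2 := by
  rw [← Complex.ofReal_mul, Real.mul_self_sqrt (by norm_num)]
  norm_num

theorem sqrt_two_ne_zero : ((Real.sqrt 2 : ℝ) : ℂ) ≠ 0 := by
  intro h
  have := sqrt_two_mul_self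
  rw [h] at this
  norm_num at this

theorem omega_eq : omega = (1 + Complex.I) / ((Real.sqrt 2 : ℝ) : ℂ) := by
  have h : Complex.I * (Real.pi : ℂ) / 4 = ((Real.pi / 4 : ℝ) : ℂ) * Complex.I := by
    push_cast; ring
  have h2 := sqrt_two_mul_self
  have h0 := sqrt_two_ne_zero
  rw [omega, h, Complex.exp_mul_I, ← Complex.ofReal_cos, ← Complex.ofReal_sin,
    Real.cos_pi_div_four, Real.sin_pi_div_four]
  push_cast
  field_simp
  linear_combination (1 + Complex.I) * h2

theorem norm_omega : ‖omega‖ = 1 := by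
  have h : Complex.I * (Real.pi : ℂ) / 4 = ((Real.pi / 4 : ℝ) : ℂ) * Complex.I := by
    push_cast; ring
  rw [omega, h, Complex.norm_exp_ofReal_mul_I]

theorem omega_ne_zero : omega ≠ 0 := Complex.exp_ne_zero _

theorem norm_omega_zpow (a : ℤ) : ‖omega ^ a‖ = 1 := by
  rw [norm_zpow, norm_omega, one_zpow]

theorem mul_conj_of_norm_eq_one {p : ℂ} (hp : ‖p‖ = 1) : p * starRingEnd ℂ p = 1 := by
  rw [Complex.mul_conj, Complex.normSq_eq_norm_sq, hp]
  norm_num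

theorem conj_omega_zpow (a : ℤ) : starRingEnd ℂ (omega ^ a) = omega ^ (-a) := by
  have h := mul_conj_of_norm_eq_one (norm_omega_zpow a)
  rw [zpow_neg]
  exact eq_inv_of_mul_eq_one_right h

theorem omega_sq : omega ^ 2 = Complex.I := by
  have h2 := sqrt_two_mul_self
  have h0 := sqrt_two_ne_zero
  rw [omega_eq]
  field_simp
  linear_combination Complex.I_sq - Complex.I * h2

theorem omega_pow_four : omega ^ 4 = -1 := by
  rw [show 4 = 2 * 2 from rfl, pow_mul, omega_sq, Complex.I_sq]

theorem omega_zpow_even (j : ℤ) : omega ^ (2 * j) = Complex.I ^ j := by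
  rw [zpow_mul, ← omega_sq]
  norm_cast

theorem I_zpow_cases (j : ℤ) :
    Complex.I ^ j = 1 ∨ Complex.I ^ j = Complex.I ∨ Complex.I ^ j = -1 ∨
      Complex.I ^ j = -Complex.I := by
  have h4 : Complex.I ^ (4 : ℤ) = 1 := by exact_mod_cast Complex.I_pow_four
  have hj : j = 4 * (j / 4) + j % 4 := by omega
  have hr : j % 4 = 0 ∨ j % 4 = 1 ∨ j % 4 = 2 ∨ j % 4 = 3 := by omega
  have e : Complex.I ^ j = Complex.I ^ (j % 4) := by
    conv_lhs => rw [hj]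
    rw [zpow_add₀ Complex.I_ne_zero, zpow_mul, h4, one_zpow, one_mul]
  rw [e]
  rcases hr with h | h | h | h <;> rw [h]
  · left; simp
  · right; left; simp
  · right; right; left
    exact_mod_cast Complex.I_sq
  · right; right; right
    exact_mod_cast Complex.I_pow_three

/-- √2 ω = 1 + i, and powers of i permute the numbers ±1 ± i. Oddness of both coordinates later
makes a T gate act on residues without cancellation. -/
theorem sqrt_two_mul_omega_zpow_odd {a : ℤ} (ha : Odd a) :
    ∃ s t : ℤ, Odd s ∧ Odd t ∧
      ((Real.sqrt 2 : ℝ) : ℂ) * omega ^ a = (s : ℂ) + (t : ℂ) * Complex.I := by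
  obtain ⟨j, rfl⟩ := ha
  have h1 : ((Real.sqrt 2 : ℝ) : ℂ) * omega = 1 + Complex.I := by
    rw [omega_eq]; field_simp [sqrt_two_ne_zero]
  have h : ((Real.sqrt 2 : ℝ) : ℂ) * omega ^ (2 * j + 1)
      = (1 + Complex.I) * Complex.I ^ j := by
    rw [zpow_add₀ omega_ne_zero, omega_zpow_even, zpow_one, ← h1]; ring
  rw [h]
  rcases I_zpow_cases j with h | h | h | h <;> rw [h]
  · exact ⟨1, 1, by decide, by decide, by push_cast; ring⟩
  · exact ⟨-1, 1, by decide, by decide, by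
      push_cast; linear_combination Complex.I_sq⟩
  · exact ⟨-1, -1, by decide, by decide, by push_cast; ring⟩
  · exact ⟨1, -1, by decide, by decide, by
      push_cast; linear_combination -Complex.I_sq⟩

theorem I_mem : Complex.I ∈ ringZf := Subring.subset_closure (by simp)

theorem inv_sqrt_two_mem : 1 / ((Real.sqrt 2 : ℝ) : ℂ) ∈ ringZf :=
  Subring.subset_closure (by simp)

theorem omega_mem : omega ∈ ringZf := by
  have : omega = (1 + Complex.I) * (1 / ((Real.sqrt 2 : ℝ) : ℂ)) := by
    rw [omega_eq]; ring
  rw [this]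
  exact mul_mem (add_mem (one_mem _) I_mem) inv_sqrt_two_mem

theorem conj_mem {x : ℂ} (hx : x ∈ ringZf) : starRingEnd ℂ x ∈ ringZf := by
  induction hx using Subring.closure_induction with
  | mem x hx =>
    rcases hx with rfl | rfl
    · rw [Complex.conj_I]; exact neg_mem I_mem
    · rw [map_div₀, map_one, Complex.conj_ofReal]; exact inv_sqrt_two_mem
  | zero => rw [map_zero]; exact zero_mem _
  | one => rw [map_one]; exact one_mem _
  | add x y _ _ hx hy => rw [map_add]; exact add_mem hx hy
  | neg x _ hx => rw [map_neg]; exact neg_mem hx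
  | mul x y _ _ hx hy => rw [map_mul]; exact mul_mem hx hy

theorem omega_zpow_mem (a : ℤ) : omega ^ a ∈ ringZf := by
  obtain ⟨n, rfl | rfl⟩ := a.eq_nat_or_neg
  · rw [zpow_natCast]; exact pow_mem omega_mem n
  · rw [← conj_omega_zpow, zpow_natCast]; exact conj_mem (pow_mem omega_mem n)

theorem int_add_sqrt_two_mul_eq_zero {p q : ℤ} (h : (p : ℝ) + Real.sqrt 2 * q = 0) :
    p = 0 ∧ q = 0 := by
  have hq : q = 0 := by
    by_contra hq
    have hq' : (q : ℝ) ≠ 0 := by exact_mod_cast hq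
    apply irrational_sqrt_two
    refine ⟨-(p : ℚ) / q, ?_⟩
    push_cast
    field_simp
    linarith
  subst hq
  refine ⟨?_, rfl⟩
  simpa using h

theorem omega_linearIndependent {a b c d : ℤ}
    (h : (a : ℂ) + b * omega + c * omega ^ 2 + d * omega ^ 3 = 0) :
    a = 0 ∧ b = 0 ∧ c = 0 ∧ d = 0 := by
  have h2 := sqrt_two_mul_self
  have h1 : ((Real.sqrt 2 : ℝ) : ℂ) * omega = 1 + Complex.I := by
    rw [omega_eq]; field_simp [sqrt_two_ne_zero]
  have h3 : ((Real.sqrt 2 : ℝ) : ℂ) * omega ^ 3 = -1 + Complex.I := by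
    rw [pow_succ, omega_sq]; linear_combination Complex.I * h1 + Complex.I_sq
  rw [omega_sq] at h
  have key : ((b - d : ℝ) + Real.sqrt 2 * a : ℂ)
      + ((b + d : ℝ) + Real.sqrt 2 * c : ℂ) * Complex.I = 0 := by
    push_cast
    -- After multiplication by √2 the real and imaginary parts lie in ℤ[√2], since √2 ω = 1 + i and
    -- √2 ω³ = −1 + i.
    linear_combination ((Real.sqrt 2 : ℝ) : ℂ) * h - b * h1 - d * h3
  have hre := congrArg Complex.re key
  have him := congrArg Complex.im key
  simp at hre him
  obtain ⟨e1, e2⟩ := int_add_sqrt_two_mul_eq_zero (p := b - d) (q := a) (by push_cast; linarith)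
  obtain ⟨e3, e4⟩ := int_add_sqrt_two_mul_eq_zero (p := b + d) (q := c) (by push_cast; linarith)
  omega

theorem exists_coeffs_of_mem {x : ℂ} (hx : x ∈ ringZf) : ∃ (m : ℕ) (a b c d : ℤ),
    2 ^ m * x = (a : ℂ) + b * omega + c * omega ^ 2 + d * omega ^ 3 := by
  have w4 := omega_pow_four
  induction hx using Subring.closure_induction with
  | mem x hx =>
    rcases hx with rfl | rfl
    · exact ⟨0, 0, 0, 1, 0, by rw [omega_sq]; push_cast; ring⟩
    -- 1/√2 = (ω − ω³)/2, so powers of 2 suffice as denominators.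
    · refine ⟨1, 0, 1, 0, -1, ?_⟩
      have h2 := sqrt_two_mul_self
      have h0 := sqrt_two_ne_zero
      rw [pow_succ omega 2, omega_sq, omega_eq]
      push_cast
      field_simp
      linear_combination Complex.I_sq
  | zero => exact ⟨0, 0, 0, 0, 0, by simp⟩
  | one => exact ⟨0, 1, 0, 0, 0, by simp⟩
  | add x y _ _ hx hy =>
    obtain ⟨m, a, b, c, d, h⟩ := hx
    obtain ⟨m', a', b', c', d', h'⟩ := hy
    refine ⟨m + m', 2 ^ m' * a + 2 ^ m * a', 2 ^ m' * b + 2 ^ m * b',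
      2 ^ m' * c + 2 ^ m * c', 2 ^ m' * d + 2 ^ m * d', ?_⟩
    push_cast
    rw [pow_add]
    linear_combination 2 ^ m' * h + 2 ^ m * h'
  | neg x _ hx =>
    obtain ⟨m, a, b, c, d, h⟩ := hx
    refine ⟨m, -a, -b, -c, -d, ?_⟩
    push_cast
    linear_combination -h
  | mul x y _ _ hx hy =>
    obtain ⟨m, a, b, c, d, h⟩ := hx
    obtain ⟨m', a', b', c', d', h'⟩ := hy
    refine ⟨m + m', a * a' - b * d' - c * c' - d * b', a * b' + b * a' - c * d' - d * c',
      a * c' + b * b' + c * a' - d * d', a * d' + b * c' + c * b' + d * a', ?_⟩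
    have e : (2 : ℂ) ^ (m + m') * (x * y) = (2 ^ m * x) * (2 ^ m' * y) := by
      rw [pow_add]; ring
    rw [e, h, h']
    push_cast
    linear_combination
      ((b : ℂ) * d' + c * c' + d * b' + (c * d' + d * c') * omega + d * d' * omega ^ 2) * w4

/-- The proof reduces modulo `41` via `ω ↦ 3`, and `3` is not a square there. -/
theorem sq_ne_omega {v : ℂ} (hv : v ∈ ringZf) : v ^ 2 ≠ omega := by
  intro h
  obtain ⟨m, a, b, c, d, e⟩ := exists_coeffs_of_mem hv
  have w4 := omega_pow_four
  have key : ((a ^ 2 - c ^ 2 - 2 * b * d : ℤ) : ℂ)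
      + ((2 * a * b - 2 * c * d - 4 ^ m : ℤ) : ℂ) * omega
      + ((2 * a * c + b ^ 2 - d ^ 2 : ℤ) : ℂ) * omega ^ 2
      + ((2 * a * d + 2 * b * c : ℤ) : ℂ) * omega ^ 3 = 0 := by
    have e2 : ((a : ℂ) + b * omega + c * omega ^ 2 + d * omega ^ 3) ^ 2 = 4 ^ m * omega := by
      rw [← e, mul_pow, h, ← pow_mul, mul_comm m 2, pow_mul]; norm_num
    push_cast
    linear_combination e2 -
      ((c : ℂ) ^ 2 + 2 * b * d + 2 * c * d * omega + d ^ 2 * omega ^ 2) * w4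
  obtain ⟨h0, h1, h2, h3⟩ := omega_linearIndependent key
  -- Sending ω to 3 respects ω⁴ = −1, because 3⁴ = 81 = −1 modulo 41.
  have hz : ((a : ZMod 41) + 3 * b + 9 * c + 27 * d) ^ 2 = 3 * (2 ^ m) ^ 2 := by
    have k0 := congrArg (Int.cast : ℤ → ZMod 41) h0
    have k1 := congrArg (Int.cast : ℤ → ZMod 41) h1
    have k2 := congrArg (Int.cast : ℤ → ZMod 41) h2
    have k3 := congrArg (Int.cast : ℤ → ZMod 41) h3
    push_cast at k0 k1 k2 k3
    have h41 : (41 : ZMod 41) = 0 := by decide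
    have h4 : (4 : ZMod 41) ^ m = (2 ^ m) ^ 2 := by
      rw [← pow_mul, mul_comm m 2, pow_mul]; norm_num
    linear_combination k0 + 3 * k1 + 9 * k2 + 27 * k3 + 3 * h4 +
      (2 * (c : ZMod 41) ^ 2 + 4 * b * d + 12 * c * d + 18 * d ^ 2) * h41
  have h2m : IsUnit ((2 : ZMod 41) ^ m) := IsUnit.pow m (by decide)
  obtain ⟨u, hu⟩ := h2m
  rw [← hu] at hz
  have hsq : (((a : ZMod 41) + 3 * b + 9 * c + 27 * d) * ((u⁻¹ : (ZMod 41)ˣ) : ZMod 41)) ^ 2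
      = 3 := by
    rw [mul_pow, hz, mul_assoc, ← mul_pow, Units.mul_inv, one_pow, mul_one]
  have : ∀ z : ZMod 41, z ^ 2 ≠ 3 := by decide
  exact this _ hsq

/-! ### Monomial matrices -/

/-- The diagonal matrix `p · diag(1, ω ^ a)`. -/
noncomputable def diagMat (p : ℂ) (a : ℤ) : Matrix (Fin 2) (Fin 2) ℂ :=
  !![p, 0; 0, p * omega ^ a]

/-- The antidiagonal matrix `p · diag(1, ω ^ a) · X`. -/
noncomputable def antiMat (p : ℂ) (a : ℤ) : Matrix (Fin 2) (Fin 2) ℂ :=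
  !![0, p; p * omega ^ a, 0]

/-- Monomial matrices with a phase `p` and exponent `a`. -/
def IsMonomial (a : ℤ) (d : Matrix (Fin 2) (Fin 2) ℂ) : Prop :=
  ∃ p : ℂ, ‖p‖ = 1 ∧ (d = diagMat p a ∨ d = antiMat p a)

theorem diagMat_mul_diagMat (p q : ℂ) (a b : ℤ) :
    diagMat p a * diagMat q b = diagMat (p * q) (a + b) := by
  simp only [diagMat, Matrix.mul_fin_two, zpow_add₀ omega_ne_zero]
  ext i j; fin_cases i <;> fin_cases j <;> simp
  ring

theorem diagMat_mul_antiMat (p q : ℂ) (a b : ℤ) :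
    diagMat p a * antiMat q b = antiMat (p * q) (a + b) := by
  simp only [diagMat, antiMat, Matrix.mul_fin_two, zpow_add₀ omega_ne_zero]
  ext i j; fin_cases i <;> fin_cases j <;> simp
  ring

theorem antiMat_mul_diagMat (p q : ℂ) (a b : ℤ) :
    antiMat p a * diagMat q b = antiMat (p * q * omega ^ b) (a - b) := by
  have h : omega ^ (a - b) * omega ^ b = omega ^ a := by
    rw [← zpow_add₀ omega_ne_zero]; congr 1; ring
  simp only [diagMat, antiMat, Matrix.mul_fin_two]
  ext i j; fin_cases i <;> fin_cases j <;> simp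
  · ring
  · linear_combination -(p * q) * h

theorem antiMat_mul_antiMat (p q : ℂ) (a b : ℤ) :
    antiMat p a * antiMat q b = diagMat (p * q * omega ^ b) (a - b) := by
  have h : omega ^ (a - b) * omega ^ b = omega ^ a := by
    rw [← zpow_add₀ omega_ne_zero]; congr 1; ring
  simp only [diagMat, antiMat, Matrix.mul_fin_two]
  ext i j; fin_cases i <;> fin_cases j <;> simp
  · ring
  · linear_combination -(p * q) * h

theorem smul_diagMat (c p : ℂ) (a : ℤ) : c • diagMat p a = diagMat (c * p) a := by
  ext i j; fin_cases i <;> fin_cases j <;> simp [diagMat, mul_assoc]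

theorem smul_antiMat (c p : ℂ) (a : ℤ) : c • antiMat p a = antiMat (c * p) a := by
  ext i j; fin_cases i <;> fin_cases j <;> simp [antiMat, mul_assoc]

theorem diagMat_one_zero : diagMat 1 0 = 1 := by
  ext i j; fin_cases i <;> fin_cases j <;> simp [diagMat]

/-- Moving X past diag(1, ω^b) flips the sign of b at the cost of a phase, so exponents add or
subtract. Either way their parity is additive. -/
theorem IsMonomial.mul {a b : ℤ} {d e : Matrix (Fin 2) (Fin 2) ℂ}
    (hd : IsMonomial a d) (he : IsMonomial b e) :
    ∃ c, IsMonomial c (d * e) ∧ (Even c ↔ (Even a ↔ Even b)) := by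
  obtain ⟨p, hp, rfl | rfl⟩ := hd <;> obtain ⟨q, hq, rfl | rfl⟩ := he
  · exact ⟨a + b, ⟨p * q, by simp [hp, hq], .inl (diagMat_mul_diagMat ..)⟩, Int.even_add⟩
  · exact ⟨a + b, ⟨p * q, by simp [hp, hq], .inr (diagMat_mul_antiMat ..)⟩, Int.even_add⟩
  · exact ⟨a - b, ⟨p * q * omega ^ b, by simp [hp, hq, norm_omega],
      .inr (antiMat_mul_diagMat ..)⟩, Int.even_sub⟩
  · exact ⟨a - b, ⟨p * q * omega ^ b, by simp [hp, hq, norm_omega],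
      .inl (antiMat_mul_antiMat ..)⟩, Int.even_sub⟩

theorem isMonomial_one : IsMonomial 0 1 := ⟨1, by simp, .inl diagMat_one_zero.symm⟩

theorem gateT_eq : gateT = diagMat 1 1 := by
  ext i j; fin_cases i <;> fin_cases j <;> simp [diagMat, gateT]

theorem gateP_eq : gateP = diagMat 1 2 := by
  rw [gateP, gateT_eq, sq, diagMat_mul_diagMat]; norm_num

theorem gateX_eq : gateX = antiMat 1 0 := by
  ext i j; fin_cases i <;> fin_cases j <;> simp [antiMat, gateX]

theorem gateZ_eq : gateZ = diagMat 1 4 := by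
  have : omega ^ (4 : ℤ) = -1 := by exact_mod_cast omega_pow_four
  ext i j; fin_cases i <;> fin_cases j <;> simp [diagMat, gateZ, this]

theorem gateY_eq : gateY = antiMat (Complex.I * omega ^ (4 : ℤ)) (-4) := by
  rw [gateY, gateX_eq, gateZ_eq, antiMat_mul_diagMat, smul_antiMat]; norm_num

theorem isMonomial_gateT : IsMonomial 1 gateT := ⟨1, by simp, .inl gateT_eq⟩
theorem isMonomial_gateP : IsMonomial 2 gateP := ⟨1, by simp, .inl gateP_eq⟩
theorem isMonomial_gateX : IsMonomial 0 gateX := ⟨1, by simp, .inr gateX_eq⟩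
theorem isMonomial_gateZ : IsMonomial 4 gateZ := ⟨1, by simp, .inl gateZ_eq⟩
theorem isMonomial_gateY : IsMonomial (-4) gateY :=
  ⟨Complex.I * omega ^ (4 : ℤ), by simp [norm_omega], .inr gateY_eq⟩

theorem gateH_eq : gateH = !![1 / ((Real.sqrt 2 : ℝ) : ℂ), 1 / ((Real.sqrt 2 : ℝ) : ℂ);
    1 / ((Real.sqrt 2 : ℝ) : ℂ), -(1 / ((Real.sqrt 2 : ℝ) : ℂ))] := by
  ext i j; fin_cases i <;> fin_cases j <;> simp [gateH]

theorem gateH_mul_gateH : gateH * gateH = 1 := by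
  have h2 := sqrt_two_mul_self
  have h0 := sqrt_two_ne_zero
  rw [gateH_eq]
  ext i j
  fin_cases i <;> fin_cases j <;> simp [Matrix.mul_apply, Fin.sum_univ_two] <;>
    field_simp <;> linear_combination -h2

theorem antiMat_eq_diagMat_mul (p : ℂ) (a : ℤ) : antiMat p a = diagMat p a * gateX := by
  rw [gateX_eq, diagMat_mul_antiMat]; simp

theorem gateX_mul_gateH : gateX * gateH = gateH * gateZ := by
  rw [gateH_eq]
  ext i j
  fin_cases i <;> fin_cases j <;> simp [Matrix.mul_apply, Fin.sum_univ_two, gateX, gateZ]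

/-- For i^j = ±1 the conjugate by H is 1 or X up to phase. For i^j = ±i it follows from HPH = ω
P⁻¹HP⁻¹ and its inverse counterpart HP⁻¹H = ω⁻¹ PHP. -/
theorem gateH_diagMat_gateH {p : ℂ} (hp : ‖p‖ = 1) (j : ℤ) :
    (∃ a, Even a ∧ IsMonomial a (gateH * diagMat p (2 * j) * gateH)) ∨
    ∃ a b e f, Even a ∧ Even b ∧ IsMonomial a e ∧ IsMonomial b f ∧
      gateH * diagMat p (2 * j) * gateH = e * gateH * f := by
  have h2 := sqrt_two_mul_self
  have h0 := sqrt_two_ne_zero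
  have hi := Complex.I_sq
  have w2 : omega ^ (2 : ℤ) = Complex.I := by exact_mod_cast omega_sq
  have w6 : omega ^ (-2 : ℤ) = -Complex.I := by
    rw [zpow_neg, w2, Complex.inv_I]
  have w1 : ((Real.sqrt 2 : ℝ) : ℂ) * omega = 1 + Complex.I := by
    rw [omega_eq]; field_simp
  have w7 : ((Real.sqrt 2 : ℝ) : ℂ) * omega ^ (-1 : ℤ) = 1 - Complex.I := by
    have : omega ^ (-1 : ℤ) = omega * omega ^ (-2 : ℤ) := by
      rw [← zpow_one_add₀ omega_ne_zero]; norm_num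
    rw [this, w6]; linear_combination -Complex.I * w1 - hi
  rcases I_zpow_cases j with h | h | h | h
  · refine .inl ⟨0, by decide, p, hp, .inl ?_⟩
    rw [gateH_eq, diagMat, diagMat, omega_zpow_even, h]
    ext i j
    fin_cases i <;> fin_cases j <;> simp [Matrix.mul_apply, Fin.sum_univ_two] <;>
      field_simp <;> linear_combination -p * h2
  · refine .inr ⟨-2, -2, diagMat (p * omega) (-2), diagMat 1 (-2), by decide, by decide,
      ⟨p * omega, by simp [hp, norm_omega], .inl rfl⟩, ⟨1, by simp, .inl rfl⟩, ?_⟩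
    rw [gateH_eq, diagMat, diagMat, diagMat, omega_zpow_even, h, w6]
    ext i j
    fin_cases i <;> fin_cases j <;> simp [Matrix.mul_apply, Fin.sum_univ_two] <;>
      field_simp
    · linear_combination -p * w1
    · linear_combination p * Complex.I * w1 + p * hi
    · linear_combination p * Complex.I * w1 + p * hi
    · linear_combination -p * w1 + p * ((Real.sqrt 2 : ℝ) : ℂ) * omega * hi
  · refine .inl ⟨0, by decide, p, hp, .inr ?_⟩
    rw [gateH_eq, diagMat, antiMat, omega_zpow_even, h]
    ext i j
    fin_cases i <;> fin_cases j <;> simp [Matrix.mul_apply, Fin.sum_univ_two] <;>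
      field_simp <;> linear_combination -p * h2
  · refine .inr ⟨2, 2, diagMat (p * omega ^ (-1 : ℤ)) 2, diagMat 1 2, by decide, by decide,
      ⟨p * omega ^ (-1 : ℤ), by simp [hp, norm_omega], .inl rfl⟩, ⟨1, by simp, .inl rfl⟩, ?_⟩
    rw [gateH_eq, diagMat, diagMat, diagMat, omega_zpow_even, h, w2]
    generalize omega ^ (-1 : ℤ) = v at w7
    ext i j
    fin_cases i <;> fin_cases j <;> simp [Matrix.mul_apply, Fin.sum_univ_two] <;>
      field_simp
    · linear_combination -p * w7
    · linear_combination -p * Complex.I * w7 + p * hi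
    · linear_combination -p * Complex.I * w7 + p * hi
    · linear_combination -p * w7 + p * ((Real.sqrt 2 : ℝ) : ℂ) * v * hi

theorem gateH_monomial_gateH {a : ℤ} (ha : Even a) {d : Matrix (Fin 2) (Fin 2) ℂ}
    (hd : IsMonomial a d) :
    (∃ b, Even b ∧ IsMonomial b (gateH * d * gateH)) ∨
    ∃ b c e f, Even b ∧ Even c ∧ IsMonomial b e ∧ IsMonomial c f ∧
      gateH * d * gateH = e * gateH * f := by
  obtain ⟨j, rfl⟩ := ha.exists_two_nsmul
  simp only [nsmul_eq_mul, Nat.cast_ofNat] at hd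
  obtain ⟨p, hp, rfl | rfl⟩ := hd
  · exact gateH_diagMat_gateH hp j
  · have e : gateH * antiMat p (2 * j) * gateH = gateH * diagMat p (2 * j) * gateH * gateZ := by
      rw [antiMat_eq_diagMat_mul]
      simp only [Matrix.mul_assoc, gateX_mul_gateH]
    rw [e]
    rcases gateH_diagMat_gateH hp j with ⟨b, hb, h⟩ | ⟨b, c, x, y, hb, hc, hx, hy, h⟩
    · obtain ⟨c, hc, hc'⟩ := h.mul isMonomial_gateZ
      exact .inl ⟨c, hc'.2 (by simp [hb]; decide), hc⟩
    · obtain ⟨c', hm, hc'⟩ := hy.mul isMonomial_gateZ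
      refine .inr ⟨b, c', x, y * gateZ, hb, hc'.2 (by simp [hc]; decide), hx, hm, ?_⟩
      rw [h, Matrix.mul_assoc]

/-! ### Normal forms -/

/-- `Core m V`: `V = H d₁ H d₂ H ⋯ dₘ H` with monomial matrices `dⱼ` of odd exponent. -/
inductive Core : ℕ → Matrix (Fin 2) (Fin 2) ℂ → Prop
  | base : Core 0 gateH
  | step (m : ℕ) (a : ℤ) (d V : Matrix (Fin 2) (Fin 2) ℂ) (ha : Odd a) (hd : IsMonomial a d)
      (hV : Core m V) : Core (m + 1) (gateH * d * V)

/-- `W` is monomial, or the product of a core with monomial matrices on both sides. -/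
def HasNormalForm (W : Matrix (Fin 2) (Fin 2) ℂ) : Prop :=
  (∃ a, IsMonomial a W) ∨
    ∃ m a b d V d', Core m V ∧ IsMonomial a d ∧ IsMonomial b d' ∧ W = d * V * d'

theorem HasNormalForm.monomial_mul {a : ℤ} {e W : Matrix (Fin 2) (Fin 2) ℂ}
    (he : IsMonomial a e) (hW : HasNormalForm W) : HasNormalForm (e * W) := by
  rcases hW with ⟨b, hb⟩ | ⟨m, b, c, d, V, d', hV, hd, hd', rfl⟩
  · obtain ⟨c, hc, -⟩ := he.mul hb
    exact .inl ⟨c, hc⟩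
  · obtain ⟨f, hf, -⟩ := he.mul hd
    exact .inr ⟨m, f, c, e * d, V, d', hV, hf, hd', by simp only [Matrix.mul_assoc]⟩

/-- If the left monomial d is odd, H d extends the core. If it is even, H d H is rewritten: either
it is monomial and the core loses its first H, or it is e H f with f even, and f merges into the
next factor without changing its odd parity. -/
theorem HasNormalForm.gateH_mul {W : Matrix (Fin 2) (Fin 2) ℂ} (hW : HasNormalForm W) :
    HasNormalForm (gateH * W) := by
  rcases hW with ⟨b, hb⟩ | ⟨m, b, c, d, V, d', hV, hd, hd', rfl⟩
  · exact .inr ⟨0, 0, b, 1, gateH, W, .base, isMonomial_one, hb, by rw [Matrix.one_mul]⟩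
  · rcases Int.even_or_odd b with hb | hb
    · cases hV with
      | base =>
        rcases gateH_monomial_gateH hb hd with ⟨f, -, h⟩ | ⟨f, g, x, y, -, -, hx, hy, h⟩
        · obtain ⟨k, hk, -⟩ := h.mul hd'
          exact .inl ⟨k, by simpa only [Matrix.mul_assoc] using hk⟩
        · obtain ⟨k, hk, -⟩ := hy.mul hd'
          refine .inr ⟨0, f, k, x, gateH, y * d', .base, hx, hk, ?_⟩
          rw [← Matrix.mul_assoc, ← Matrix.mul_assoc, h]
          simp only [Matrix.mul_assoc]
      | step m a e V ha he hV =>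
        rcases gateH_monomial_gateH hb hd with ⟨f, -, h⟩ | ⟨f, g, x, y, -, hg, hx, hy, h⟩
        · obtain ⟨k, hk, -⟩ := h.mul he
          refine .inr ⟨m, k, c, _, V, d', hV, hk, hd', ?_⟩
          simp only [Matrix.mul_assoc]
        · obtain ⟨k, hk, hk'⟩ := hy.mul he
          have hko : Odd k := by
            rw [← Int.not_even_iff_odd] at ha ⊢
            tauto
          refine .inr ⟨m + 1, f, c, x, _, d', .step m k (y * e) V hko hk hV, hx, hd', ?_⟩
          have : gateH * (d * (gateH * e * V) * d') = (gateH * d * gateH) * e * V * d' := by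
            simp only [Matrix.mul_assoc]
          rw [this, h]
          simp only [Matrix.mul_assoc]
    · exact .inr ⟨m + 1, 0, c, 1, _, d', .step m b d V hb hd hV, isMonomial_one, hd', by
        simp only [Matrix.mul_assoc, Matrix.one_mul]⟩

/-- Circuits are built by left multiplication by single gates, so an invariant need only be checked
for each generator and for T. -/
theorem circuit_induction {Q : ℕ → Matrix (Fin 2) (Fin 2) ℂ → Prop} (h1 : Q 0 1)
    (hG : ∀ n, ∀ g ∈ ({gateX, gateY, gateZ, gateH, gateP} : Set (Matrix (Fin 2) (Fin 2) ℂ)),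
      ∀ W, Q n W → Q n (g * W))
    (hT : ∀ n W, Q n W → Q (n + 1) (gateT * W))
    {n : ℕ} {W : Matrix (Fin 2) (Fin 2) ℂ} (hW : CircuitWith n W) : Q n W := by
  have hC : ∀ n, ∀ C ∈ cliffords, ∀ W, Q n W → Q n (C * W) := by
    intro n C hC
    induction hC using Submonoid.closure_induction with
    | mem x hx => exact hG n x hx
    | one => intro W hW; rwa [one_mul]
    | mul x y _ _ hx hy => intro W hW; rw [mul_assoc]; exact hx _ (hy _ hW)
  induction hW with
  | clifford C h =>
    rw [← mul_one C]
    exact hC 0 C h 1 h1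
  | step n C W h _ ih =>
    rw [mul_assoc]
    exact hC _ C h _ (hT n W ih)

theorem isMonomial_or_eq_gateH {g : Matrix (Fin 2) (Fin 2) ℂ}
    (hg : g ∈ ({gateX, gateY, gateZ, gateH, gateP} : Set (Matrix (Fin 2) (Fin 2) ℂ))) :
    (∃ a, Even a ∧ IsMonomial a g) ∨ g = gateH := by
  rcases hg with rfl | rfl | rfl | rfl | rfl
  · exact .inl ⟨_, by decide, isMonomial_gateX⟩
  · exact .inl ⟨_, by decide, isMonomial_gateY⟩
  · exact .inl ⟨_, by decide, isMonomial_gateZ⟩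
  · exact .inr rfl
  · exact .inl ⟨_, by decide, isMonomial_gateP⟩

theorem CircuitWith.hasNormalForm {n : ℕ} {W : Matrix (Fin 2) (Fin 2) ℂ}
    (hW : CircuitWith n W) : HasNormalForm W := by
  refine circuit_induction (Q := fun _ W => HasNormalForm W) (.inl ⟨0, isMonomial_one⟩)
    (fun _ g hg W hW => ?_) (fun _ _ hW => hW.monomial_mul isMonomial_gateT) hW
  rcases isMonomial_or_eq_gateH hg with ⟨a, -, h⟩ | rfl
  · exact hW.monomial_mul h
  · exact hW.gateH_mul

/-! ### Circuits up to a global phase -/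

/-- `V` is, up to a global phase, a circuit with `n` gates `T`. -/
def PhaseCircuit (n : ℕ) (V : Matrix (Fin 2) (Fin 2) ℂ) : Prop :=
  ∃ u : ℂ, ‖u‖ = 1 ∧ ∃ W, CircuitWith n W ∧ V = u • W

theorem phaseCircuit_iff {n : ℕ} {V : Matrix (Fin 2) (Fin 2) ℂ} :
    PhaseCircuit n V ↔ ∃ (α : ℝ) (W : Matrix (Fin 2) (Fin 2) ℂ),
      CircuitWith n W ∧ V = Complex.exp (Complex.I * (α : ℂ)) • W := by
  constructor
  · rintro ⟨u, hu, W, hW, rfl⟩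
    obtain ⟨α, rfl⟩ := (Complex.norm_eq_one_iff u).1 hu
    exact ⟨α, W, hW, by rw [mul_comm]⟩
  · rintro ⟨α, W, hW, rfl⟩
    exact ⟨_, by rw [mul_comm, Complex.norm_exp_ofReal_mul_I], W, hW, rfl⟩

theorem PhaseCircuit.tCount_le {n : ℕ} {V : Matrix (Fin 2) (Fin 2) ℂ} (h : PhaseCircuit n V) :
    tCount V ≤ n :=
  sInf_le ⟨n, rfl, phaseCircuit_iff.1 h⟩

theorem phaseCircuit_of_tCount_eq {n : ℕ} {V : Matrix (Fin 2) (Fin 2) ℂ} (h : tCount V = n) :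
    PhaseCircuit n V := by
  have hne : {t : ℕ∞ | ∃ n : ℕ, t = (n : ℕ∞) ∧ ∃ (α : ℝ) (W : Matrix (Fin 2) (Fin 2) ℂ),
      CircuitWith n W ∧ V = Complex.exp (Complex.I * (α : ℂ)) • W}.Nonempty := by
    by_contra hne
    rw [Set.not_nonempty_iff_eq_empty] at hne
    rw [tCount, hne, sInf_empty] at h
    exact ENat.top_ne_natCast n h
  obtain ⟨m, hm, hW⟩ := csInf_mem hne
  change tCount V = m at hm
  rw [h] at hm
  obtain rfl : n = m := by exact_mod_cast hm
  exact phaseCircuit_iff.2 hW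

theorem tCount_le_tCount {V V' : Matrix (Fin 2) (Fin 2) ℂ}
    (h : ∀ n, PhaseCircuit n V → PhaseCircuit n V') : tCount V' ≤ tCount V := by
  refine le_sInf ?_
  rintro _ ⟨n, rfl, hW⟩
  exact (h n (phaseCircuit_iff.2 hW)).tCount_le

theorem CircuitWith.clifford_mul {n : ℕ} {C W : Matrix (Fin 2) (Fin 2) ℂ} (hC : C ∈ cliffords)
    (hW : CircuitWith n W) : CircuitWith n (C * W) := by
  cases hW with
  | clifford W hW => exact .clifford _ (mul_mem hC hW)
  | step n D W hD hW =>
    rw [← mul_assoc, ← mul_assoc]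
    exact .step n _ W (mul_mem hC hD) hW

theorem CircuitWith.mul_clifford {n : ℕ} {C W : Matrix (Fin 2) (Fin 2) ℂ} (hC : C ∈ cliffords)
    (hW : CircuitWith n W) : CircuitWith n (W * C) := by
  induction hW with
  | clifford W hW => exact .clifford _ (mul_mem hW hC)
  | step n D W hD _ ih =>
    rw [mul_assoc]
    exact .step n _ _ hD ih

theorem gateX_mem : gateX ∈ cliffords := Submonoid.subset_closure (by simp)
theorem gateZ_mem : gateZ ∈ cliffords := Submonoid.subset_closure (by simp)
theorem gateH_mem : gateH ∈ cliffords := Submonoid.subset_closure (by simp)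
theorem gateP_mem : gateP ∈ cliffords := Submonoid.subset_closure (by simp)

theorem diagMat_mem_cliffords (j : ℤ) : diagMat 1 (2 * j) ∈ cliffords := by
  have w4 : omega ^ (4 : ℤ) = -1 := by exact_mod_cast omega_pow_four
  have w2 : omega ^ (2 : ℤ) = Complex.I := by exact_mod_cast omega_sq
  rw [diagMat, omega_zpow_even]
  rcases I_zpow_cases j with h | h | h | h <;> rw [h]
  · convert cliffords.one_mem
    ext i j; fin_cases i <;> fin_cases j <;> simp
  · convert gateP_mem
    rw [gateP_eq, diagMat, w2]
  · convert gateZ_mem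
    rw [gateZ_eq, diagMat, w4]
  · convert mul_mem gateP_mem gateZ_mem
    rw [gateP_eq, gateZ_eq, diagMat, diagMat, w2, w4]
    ext i j; fin_cases i <;> fin_cases j <;> simp [Matrix.mul_apply, Fin.sum_univ_two]

theorem IsMonomial.exists_clifford {a : ℤ} {d : Matrix (Fin 2) (Fin 2) ℂ} (hd : IsMonomial a d)
    (ha : Even a) : ∃ (p : ℂ) (C : Matrix (Fin 2) (Fin 2) ℂ),
      ‖p‖ = 1 ∧ C ∈ cliffords ∧ d = p • C := by
  obtain ⟨j, rfl⟩ := ha.exists_two_nsmul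
  simp only [nsmul_eq_mul, Nat.cast_ofNat] at hd
  obtain ⟨p, hp, rfl | rfl⟩ := hd
  · exact ⟨p, _, hp, diagMat_mem_cliffords j, by rw [smul_diagMat, mul_one]⟩
  · refine ⟨p, _, hp, mul_mem (diagMat_mem_cliffords j) gateX_mem, ?_⟩
    rw [← antiMat_eq_diagMat_mul, smul_antiMat, mul_one]

theorem PhaseCircuit.even_mul {n : ℕ} {a : ℤ} {d V : Matrix (Fin 2) (Fin 2) ℂ}
    (hV : PhaseCircuit n V) (ha : Even a) (hd : IsMonomial a d) : PhaseCircuit n (d * V) := by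
  obtain ⟨u, hu, W, hW, rfl⟩ := hV
  obtain ⟨p, C, hp, hC, rfl⟩ := hd.exists_clifford ha
  exact ⟨p * u, by simp [hp, hu], _, hW.clifford_mul hC, by
    rw [Matrix.smul_mul, Matrix.mul_smul, smul_smul]⟩

theorem PhaseCircuit.mul_even {n : ℕ} {a : ℤ} {d V : Matrix (Fin 2) (Fin 2) ℂ}
    (hV : PhaseCircuit n V) (ha : Even a) (hd : IsMonomial a d) : PhaseCircuit n (V * d) := by
  obtain ⟨u, hu, W, hW, rfl⟩ := hV
  obtain ⟨p, C, hp, hC, rfl⟩ := hd.exists_clifford ha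
  exact ⟨u * p, by simp [hp, hu], _, hW.mul_clifford hC, by
    rw [Matrix.smul_mul, Matrix.mul_smul, smul_smul]⟩

/-- d = T · (T⁻¹ d), and T⁻¹ d has even exponent, hence is Clifford up to phase. -/
theorem PhaseCircuit.odd_mul {n : ℕ} {a : ℤ} {d V : Matrix (Fin 2) (Fin 2) ℂ}
    (hV : PhaseCircuit n V) (ha : Odd a) (hd : IsMonomial a d) :
    PhaseCircuit (n + 1) (d * V) := by
  have hinv : IsMonomial (-1) (diagMat 1 (-1)) := ⟨1, by simp, .inl rfl⟩
  obtain ⟨b, hb, hb'⟩ := hinv.mul hd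
  have hbe : Even b := by
    rw [hb', ← Int.not_odd_iff_even, ← Int.not_odd_iff_even]
    simp [ha]
  obtain ⟨u, hu, W, hW, h⟩ := hV.even_mul hbe hb
  refine ⟨u, hu, _, .step n 1 W (one_mem _) hW, ?_⟩
  rw [one_mul, ← Matrix.mul_smul, ← h, gateT_eq, ← Matrix.mul_assoc, ← Matrix.mul_assoc,
    diagMat_mul_diagMat]
  norm_num [diagMat_one_zero]

theorem PhaseCircuit.gateH_mul {n : ℕ} {V : Matrix (Fin 2) (Fin 2) ℂ}
    (hV : PhaseCircuit n V) : PhaseCircuit n (gateH * V) := by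
  obtain ⟨u, hu, W, hW, rfl⟩ := hV
  exact ⟨u, hu, _, hW.clifford_mul gateH_mem, by rw [Matrix.mul_smul]⟩

theorem phaseCircuit_one : PhaseCircuit 0 1 :=
  ⟨1, by simp, 1, .clifford _ (one_mem _), by simp⟩

theorem Core.phaseCircuit {m : ℕ} {V : Matrix (Fin 2) (Fin 2) ℂ} (hV : Core m V) :
    PhaseCircuit m V := by
  induction hV with
  | base => simpa using phaseCircuit_one.gateH_mul
  | step m a d V ha hd _ ih =>
    rw [Matrix.mul_assoc]
    exact (ih.odd_mul ha hd).gateH_mul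

theorem PhaseCircuit.tCount_monomial_mul_le {n : ℕ} {a : ℤ} {d V : Matrix (Fin 2) (Fin 2) ℂ}
    (hV : PhaseCircuit n V) (hd : IsMonomial a d) : tCount (d * V) ≤ (n + 1 : ℕ) := by
  rcases Int.even_or_odd a with ha | ha
  · exact (hV.even_mul ha hd).tCount_le.trans (by exact_mod_cast n.le_succ)
  · exact (hV.odd_mul ha hd).tCount_le

/-! ### Residues in `ℤ[√2]` modulo `√2` -/

/-- `z ∈ ℤ[√2]`, with residue `e` modulo `√2`. -/
def HasResidue (e : ZMod 2) (z : ℝ) : Prop :=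
  ∃ p q : ℤ, z = p + Real.sqrt 2 * q ∧ (p : ZMod 2) = e

theorem HasResidue.add {e f : ZMod 2} {y z : ℝ} (hy : HasResidue e y) (hz : HasResidue f z) :
    HasResidue (e + f) (y + z) := by
  obtain ⟨p, q, rfl, rfl⟩ := hy
  obtain ⟨p', q', rfl, rfl⟩ := hz
  exact ⟨p + p', q + q', by push_cast; ring, by push_cast; ring⟩

theorem HasResidue.mul_int {e : ZMod 2} {z : ℝ} (hz : HasResidue e z) (s : ℤ) :
    HasResidue (e * s) (z * s) := by
  obtain ⟨p, q, rfl, rfl⟩ := hz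
  exact ⟨p * s, q * s, by push_cast; ring, by push_cast; ring⟩

theorem HasResidue.mul_odd {e : ZMod 2} {z : ℝ} (hz : HasResidue e z) {s : ℤ} (hs : Odd s) :
    HasResidue e (z * s) := by
  have := hz.mul_int s
  rwa [(ZMod.intCast_eq_one_iff_odd).2 hs, mul_one] at this

theorem HasResidue.neg {e : ZMod 2} {z : ℝ} (hz : HasResidue e z) : HasResidue e (-z) := by
  simpa using hz.mul_odd (s := -1) (by decide)

theorem HasResidue.sqrt_two_mul {e : ZMod 2} {z : ℝ} (hz : HasResidue e z) :
    HasResidue 0 (Real.sqrt 2 * z) := by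
  obtain ⟨p, q, rfl, rfl⟩ := hz
  refine ⟨2 * q, p, ?_, by push_cast; rw [show (2 : ZMod 2) = 0 from rfl, zero_mul]⟩
  have := Real.mul_self_sqrt (show (0 : ℝ) ≤ 2 by norm_num)
  push_cast
  linear_combination (q : ℝ) * this

theorem HasResidue.sqrt_two_pow_mul {e : ZMod 2} {z : ℝ} (hz : HasResidue e z) {n : ℕ}
    (hn : n ≠ 0) : HasResidue 0 (Real.sqrt 2 ^ n * z) := by
  induction n with
  | zero => exact absurd rfl hn
  | succ n ih =>
    rw [pow_succ', mul_assoc]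
    rcases eq_or_ne n 0 with rfl | h
    · simpa using hz.sqrt_two_mul
    · exact (ih h).sqrt_two_mul

theorem HasResidue.unique {e f : ZMod 2} {z : ℝ} (h : HasResidue e z) (h' : HasResidue f z) :
    e = f := by
  obtain ⟨p, q, rfl, rfl⟩ := h
  obtain ⟨p', q', h, rfl⟩ := h'
  have := int_add_sqrt_two_mul_eq_zero (p := p - p') (q := q - q') (by push_cast; linarith)
  rw [sub_eq_zero.1 this.1]

theorem hasResidue_intCast (p : ℤ) : HasResidue p (p : ℝ) := ⟨p, 0, by simp, rfl⟩

/-! ### Conjugates of `Z` as Bloch vectors -/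

/-- The matrix `a X + b Y + c Z`. -/
noncomputable def pauliVec (a b c : ℝ) : Matrix (Fin 2) (Fin 2) ℂ :=
  !![(c : ℂ), a - b * Complex.I; a + b * Complex.I, -(c : ℂ)]

theorem conjTranspose_diagMat (p : ℂ) (a : ℤ) : (diagMat p a)ᴴ
    = !![starRingEnd ℂ p, 0; 0, starRingEnd ℂ p * omega ^ (-a)] := by
  ext i j
  fin_cases i <;> fin_cases j <;> simp [-zpow_neg, ← conj_omega_zpow, diagMat]

theorem conjTranspose_antiMat (p : ℂ) (a : ℤ) : (antiMat p a)ᴴ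
    = !![0, starRingEnd ℂ p * omega ^ (-a); starRingEnd ℂ p, 0] := by
  ext i j
  fin_cases i <;> fin_cases j <;> simp [-zpow_neg, ← conj_omega_zpow, antiMat]

theorem omega_zpow_mul_zpow_neg (a : ℤ) : omega ^ a * omega ^ (-a) = 1 := by
  rw [← zpow_add₀ omega_ne_zero, add_neg_cancel, zpow_zero]

/-- Conjugation by diag(1, ω^k) rotates the Bloch vector about the Z axis by kπ/4. The scalar `r`
clears the denominator: it is √2 for odd k and 1 for even k. -/
theorem diagMat_conj_pauliVec {p : ℂ} (hp : ‖p‖ = 1) {k s t : ℤ} {r : ℝ}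
    (h : (r : ℂ) * omega ^ k = s + t * Complex.I) (a b c : ℝ) :
    (r : ℂ) • (diagMat p k * pauliVec a b c * (diagMat p k)ᴴ)
      = pauliVec (a * s + -(b * t)) (a * t + b * s) (r * c) := by
  have hpp := mul_conj_of_norm_eq_one hp
  have hww := omega_zpow_mul_zpow_neg k
  have h' : (r : ℂ) * omega ^ (-k) = s - t * Complex.I := by
    have := congrArg (starRingEnd ℂ) h
    rw [map_mul, conj_omega_zpow] at this
    simpa [-zpow_neg, sub_eq_add_neg] using this
  rw [conjTranspose_diagMat, diagMat, pauliVec, Matrix.mul_fin_two, Matrix.mul_fin_two]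
  ext i j
  fin_cases i <;> fin_cases j <;>
    simp [-zpow_neg, pauliVec]
  · left; linear_combination c * hpp
  · linear_combination (r : ℂ) * (a - b * Complex.I) * omega ^ (-k) * hpp
      + (a - b * Complex.I) * h' + b * t * Complex.I_sq
  · linear_combination (r : ℂ) * (a + b * Complex.I) * omega ^ k * hpp
      + (a + b * Complex.I) * h + b * t * Complex.I_sq
  · left; linear_combination c * (omega ^ k * omega ^ (-k)) * hpp + c * hww

theorem antiMat_conj_pauliVec {p : ℂ} (hp : ‖p‖ = 1) {k s t : ℤ} {r : ℝ}
    (h : (r : ℂ) * omega ^ k = s + t * Complex.I) (a b c : ℝ) :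
    (r : ℂ) • (antiMat p k * pauliVec a b c * (antiMat p k)ᴴ)
      = pauliVec (a * s + b * t) (a * t + -(b * s)) (-(r * c)) := by
  have e : antiMat p k * pauliVec a b c * (antiMat p k)ᴴ
      = diagMat p k * pauliVec a (-b) (-c) * (diagMat p k)ᴴ := by
    have hx : gateX * pauliVec a b c * gateXᴴ = pauliVec a (-b) (-c) := by
      ext i j
      fin_cases i <;> fin_cases j <;>
        simp [gateX, pauliVec, Matrix.mul_apply, Fin.sum_univ_two]
      ring
    rw [antiMat_eq_diagMat_mul, Matrix.conjTranspose_mul, ← hx]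
    simp only [Matrix.mul_assoc]
  rw [e, diagMat_conj_pauliVec hp h]
  congr 1 <;> ring

theorem gateH_conj_pauliVec (a b c : ℝ) :
    gateH * pauliVec a b c * gateHᴴ = pauliVec c (-b) a := by
  have h2 := sqrt_two_mul_self
  have h0 := sqrt_two_ne_zero
  rw [gateH_eq]
  ext i j
  fin_cases i <;> fin_cases j <;> simp [pauliVec, Matrix.mul_apply, Fin.sum_univ_two] <;>
    field_simp
  · linear_combination -(a : ℂ) * h2
  · linear_combination -(c + b * Complex.I : ℂ) * h2
  · linear_combination -(c - b * Complex.I : ℂ) * h2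
  · linear_combination (a : ℂ) * h2

/-- `√2 ^ m · W Z W†` is the matrix of a vector over `ℤ[√2]`, with the given residues. -/
def HasBlochVec (m : ℕ) (W : Matrix (Fin 2) (Fin 2) ℂ) (e : Fin 3 → ZMod 2) : Prop :=
  ∃ a b c : ℝ, HasResidue (e 0) a ∧ HasResidue (e 1) b ∧ HasResidue (e 2) c ∧
    ((Real.sqrt 2 : ℝ) : ℂ) ^ m • (W * gateZ * Wᴴ) = pauliVec a b c

theorem mul_conj_mul (c : ℂ) (d W : Matrix (Fin 2) (Fin 2) ℂ) :
    c • (d * W * gateZ * (d * W)ᴴ) = d * (c • (W * gateZ * Wᴴ)) * dᴴ := by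
  rw [Matrix.conjTranspose_mul, Matrix.mul_smul, Matrix.smul_mul]
  simp only [Matrix.mul_assoc]

theorem hasBlochVec_one : HasBlochVec 0 1 ![0, 0, 1] := by
  refine ⟨0, 0, 1, ?_, ?_, ?_, ?_⟩
  · simpa using hasResidue_intCast 0
  · simpa using hasResidue_intCast 0
  · simpa using hasResidue_intCast 1
  · ext i j; fin_cases i <;> fin_cases j <;> simp [pauliVec, gateZ]

theorem HasBlochVec.gateH_mul {m : ℕ} {W : Matrix (Fin 2) (Fin 2) ℂ} {e : Fin 3 → ZMod 2}
    (h : HasBlochVec m W e) : HasBlochVec m (gateH * W) ![e 2, e 1, e 0] := by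
  obtain ⟨a, b, c, ha, hb, hc, h⟩ := h
  exact ⟨c, -b, a, hc, hb.neg, ha, by rw [mul_conj_mul, h, gateH_conj_pauliVec]⟩

/-- The rotation in the XY plane, scaled by √2, has only odd entries, so both new coordinates reduce
to e₀ + e₁. The Z coordinate is merely multiplied by √2 and reduces to 0. -/
theorem HasBlochVec.odd_mul {m : ℕ} {k : ℤ} {d W : Matrix (Fin 2) (Fin 2) ℂ}
    {e : Fin 3 → ZMod 2} (h : HasBlochVec m W e) (hk : Odd k) (hd : IsMonomial k d) :
    HasBlochVec (m + 1) (d * W) ![e 0 + e 1, e 0 + e 1, 0] := by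
  obtain ⟨a, b, c, ha, hb, hc, h⟩ := h
  obtain ⟨s, t, hs, ht, hst⟩ := sqrt_two_mul_omega_zpow_odd hk
  obtain ⟨p, hp, rfl | rfl⟩ := hd
  · refine ⟨_, _, _, (ha.mul_odd hs).add (hb.mul_odd ht).neg,
      (ha.mul_odd ht).add (hb.mul_odd hs), hc.sqrt_two_mul, ?_⟩
    rw [pow_succ', mul_smul, mul_conj_mul, h, diagMat_conj_pauliVec hp hst]
  · refine ⟨_, _, _, (ha.mul_odd hs).add (hb.mul_odd ht),
      (ha.mul_odd ht).add (hb.mul_odd hs).neg, hc.sqrt_two_mul.neg, ?_⟩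
    rw [pow_succ', mul_smul, mul_conj_mul, h, antiMat_conj_pauliVec hp hst]

theorem omega_zpow_even_eq {k : ℤ} (hk : Even k) :
    ∃ s t : ℤ, ((1 : ℝ) : ℂ) * omega ^ k = s + t * Complex.I := by
  obtain ⟨j, rfl⟩ := hk.exists_two_nsmul
  simp only [nsmul_eq_mul, Nat.cast_ofNat, omega_zpow_even]
  rcases I_zpow_cases j with h | h | h | h <;> rw [h]
  · exact ⟨1, 0, by simp⟩
  · exact ⟨0, 1, by simp⟩
  · exact ⟨-1, 0, by simp⟩
  · exact ⟨0, -1, by simp⟩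

theorem HasBlochVec.even_mul {m : ℕ} {k : ℤ} {d W : Matrix (Fin 2) (Fin 2) ℂ}
    {e : Fin 3 → ZMod 2} (h : HasBlochVec m W e) (hk : Even k) (hd : IsMonomial k d) :
    ∃ f, HasBlochVec m (d * W) f := by
  obtain ⟨a, b, c, ha, hb, hc, h⟩ := h
  obtain ⟨s, t, hst⟩ := omega_zpow_even_eq hk
  have h1 : ∀ M : Matrix (Fin 2) (Fin 2) ℂ, M = ((1 : ℝ) : ℂ) • M := by simp
  obtain ⟨p, hp, rfl | rfl⟩ := hd
  · refine ⟨![_, _, _], _, _, _, (ha.mul_int s).add (hb.mul_int t).neg,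
      (ha.mul_int t).add (hb.mul_int s), hc, ?_⟩
    rw [mul_conj_mul, h, h1 (_ * _ * _), diagMat_conj_pauliVec hp hst, one_mul]
  · refine ⟨![_, _, _], _, _, _, (ha.mul_int s).add (hb.mul_int t),
      (ha.mul_int t).add (hb.mul_int s).neg, hc.neg, ?_⟩
    rw [mul_conj_mul, h, h1 (_ * _ * _), antiMat_conj_pauliVec hp hst, one_mul]

/-- Only T gates enlarge the denominator, each by one factor √2. This is what bounds the number of T
gates from below. -/
theorem CircuitWith.hasBlochVec {n : ℕ} {W : Matrix (Fin 2) (Fin 2) ℂ}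
    (hW : CircuitWith n W) : ∃ e, HasBlochVec n W e := by
  refine circuit_induction (Q := fun n W => ∃ e, HasBlochVec n W e) ⟨_, hasBlochVec_one⟩
    (fun _ g hg W hW => ?_) (fun _ _ ⟨_, hW⟩ => ⟨_, hW.odd_mul odd_one isMonomial_gateT⟩) hW
  obtain ⟨e, hW⟩ := hW
  rcases isMonomial_or_eq_gateH hg with ⟨a, ha, h⟩ | rfl
  · exact hW.even_mul ha h
  · exact ⟨_, hW.gateH_mul⟩

/-- The invariant e₀ + e₁ = 1 drives the induction: it holds for HZH† = X, an odd factor then gives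
(1,1,0), and H turns this into (0,1,1), where it holds again. So the denominator √2^m never cancels
in the Z coordinate once m > 0. -/
theorem Core.exists_hasBlochVec {m : ℕ} {V : Matrix (Fin 2) (Fin 2) ℂ} (hV : Core m V) :
    ∃ e, HasBlochVec m V e ∧ e 0 + e 1 = 1 ∧ (m ≠ 0 → e 2 = 1) := by
  induction hV with
  | base =>
    refine ⟨_, by simpa using hasBlochVec_one.gateH_mul, ?_⟩
    simp
  | step m a d V ha hd _ ih =>
    obtain ⟨e, h, he, -⟩ := ih
    rw [Matrix.mul_assoc]
    refine ⟨_, (h.odd_mul ha hd).gateH_mul, ?_⟩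
    simp [he]

theorem HasBlochVec.apply_zero_zero {m : ℕ} {W : Matrix (Fin 2) (Fin 2) ℂ}
    {e : Fin 3 → ZMod 2} (h : HasBlochVec m W e) {z : ℝ} (hz : (W * gateZ * Wᴴ) 0 0 = z) :
    HasResidue (e 2) (Real.sqrt 2 ^ m * z) := by
  obtain ⟨a, b, c, -, -, hc, h⟩ := h
  have := congrFun (congrFun h 0) 0
  simp only [Matrix.smul_apply, hz, pauliVec, Matrix.of_apply, Matrix.cons_val_zero,
    smul_eq_mul] at this
  have e : Real.sqrt 2 ^ m * z = c := by exact_mod_cast this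
  rwa [e]

theorem IsMonomial.conj_gateZ {a : ℤ} {d : Matrix (Fin 2) (Fin 2) ℂ} (hd : IsMonomial a d) :
    d * gateZ * dᴴ = gateZ ∨ d * gateZ * dᴴ = -gateZ := by
  have hww := omega_zpow_mul_zpow_neg a
  obtain ⟨p, hp, rfl | rfl⟩ := hd <;> have hpp := mul_conj_of_norm_eq_one hp
  · left
    rw [conjTranspose_diagMat, diagMat, gateZ, Matrix.mul_fin_two, Matrix.mul_fin_two]
    ext i j
    fin_cases i <;> fin_cases j <;> simp [-zpow_neg]
    · exact hpp
    · linear_combination (omega ^ a * omega ^ (-a)) * hpp + hww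
  · right
    rw [conjTranspose_antiMat, antiMat, gateZ, Matrix.mul_fin_two, Matrix.mul_fin_two]
    ext i j
    fin_cases i <;> fin_cases j <;> simp [-zpow_neg]
    · exact hpp
    · linear_combination (omega ^ a * omega ^ (-a)) * hpp + hww

theorem IsMonomial.conj_apply_zero_zero {a : ℤ} {d M : Matrix (Fin 2) (Fin 2) ℂ}
    (hd : IsMonomial a d) (hM : M 1 1 = -M 0 0) :
    (d * M * dᴴ) 0 0 = M 0 0 ∨ (d * M * dᴴ) 0 0 = -M 0 0 := by
  obtain ⟨p, hp, rfl | rfl⟩ := hd <;> have hpp := mul_conj_of_norm_eq_one hp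
  · left
    rw [conjTranspose_diagMat, diagMat, Matrix.eta_fin_two M, Matrix.mul_fin_two,
      Matrix.mul_fin_two]
    simp
    linear_combination M 0 0 * hpp
  · right
    rw [conjTranspose_antiMat, antiMat, Matrix.eta_fin_two M, Matrix.mul_fin_two,
      Matrix.mul_fin_two]
    simp [hM]
    linear_combination M 0 0 * hpp

/-- The right factor sends Z to ±Z, and the left one fixes or negates the (0,0) entry of a traceless
matrix. Signs are invisible modulo √2. -/
theorem HasBlochVec.residue_of_monomial_mul {m : ℕ} {a b : ℤ}
    {d V d' : Matrix (Fin 2) (Fin 2) ℂ} {e : Fin 3 → ZMod 2} (h : HasBlochVec m V e)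
    (hd : IsMonomial a d) (hd' : IsMonomial b d') {z : ℝ}
    (hz : (d * V * d' * gateZ * (d * V * d')ᴴ) 0 0 = z) :
    HasResidue (e 2) (Real.sqrt 2 ^ m * z) := by
  have hr0 : (((Real.sqrt 2 : ℝ) : ℂ)) ^ m ≠ 0 := pow_ne_zero _ sqrt_two_ne_zero
  have htr : (V * gateZ * Vᴴ) 1 1 = -(V * gateZ * Vᴴ) 0 0 := by
    obtain ⟨x, y, c, -, -, -, h⟩ := h
    have h0 := congrFun (congrFun h 0) 0
    have h1 := congrFun (congrFun h 1) 1
    simp only [Matrix.smul_apply, pauliVec, Matrix.of_apply, Matrix.cons_val_zero,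
      Matrix.cons_val_one, smul_eq_mul] at h0 h1
    apply mul_left_cancel₀ hr0
    rw [h1, mul_neg, h0]
  have hsplit : d * V * d' * gateZ * (d * V * d')ᴴ
      = d * (V * (d' * gateZ * d'ᴴ) * Vᴴ) * dᴴ := by
    simp only [Matrix.conjTranspose_mul, Matrix.mul_assoc]
  have hcases : (V * gateZ * Vᴴ) 0 0 = z ∨ (V * gateZ * Vᴴ) 0 0 = ((-z : ℝ) : ℂ) := by
    rw [hsplit] at hz
    have := hd.conj_apply_zero_zero htr
    push_cast
    rcases hd'.conj_gateZ with h' | h' <;> rw [h'] at hz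
    · rcases this with h'' | h'' <;> rw [hz] at h''
      · exact .inl h''.symm
      · right; rw [h'', neg_neg]
    · simp only [Matrix.mul_neg, Matrix.neg_mul, Matrix.neg_apply] at hz
      rcases this with h'' | h'' <;> rw [h''] at hz
      · right; rw [← hz, neg_neg]
      · left; rw [← hz, neg_neg]
  rcases hcases with hc | hc
  · exact h.apply_zero_zero hc
  · have := (h.apply_zero_zero hc).neg
    rwa [mul_neg, neg_neg] at this

/-! ### Determinants and the parity of the number of `T` gates -/

theorem IsMonomial.mul_conjTranspose {a : ℤ} {d : Matrix (Fin 2) (Fin 2) ℂ}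
    (hd : IsMonomial a d) : d * dᴴ = 1 := by
  have hww := omega_zpow_mul_zpow_neg a
  obtain ⟨p, hp, rfl | rfl⟩ := hd <;> have hpp := mul_conj_of_norm_eq_one hp
  · rw [conjTranspose_diagMat, diagMat, Matrix.mul_fin_two]
    ext i j
    fin_cases i <;> fin_cases j <;> simp [-zpow_neg]
    · exact hpp
    · linear_combination (omega ^ a * omega ^ (-a)) * hpp + hww
  · rw [conjTranspose_antiMat, antiMat, Matrix.mul_fin_two]
    ext i j
    fin_cases i <;> fin_cases j <;> simp [-zpow_neg]
    · exact hpp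
    · linear_combination (omega ^ a * omega ^ (-a)) * hpp + hww

theorem conjTranspose_gateH : gateHᴴ = gateH := by
  rw [gateH_eq]
  ext i j; fin_cases i <;> fin_cases j <;> simp

theorem apply_mem_mul {A B : Matrix (Fin 2) (Fin 2) ℂ} (hA : ∀ i j, A i j ∈ ringZf)
    (hB : ∀ i j, B i j ∈ ringZf) (i j : Fin 2) : (A * B) i j ∈ ringZf := by
  rw [Matrix.mul_apply]
  exact sum_mem fun l _ => mul_mem (hA i l) (hB l j)

theorem diagMat_apply_mem {p : ℂ} (hp : p ∈ ringZf) (a : ℤ) (i j : Fin 2) :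
    diagMat p a i j ∈ ringZf := by
  fin_cases i <;> fin_cases j <;>
    simp [diagMat, hp, zero_mem, mul_mem hp (omega_zpow_mem a)]

theorem antiMat_apply_mem {p : ℂ} (hp : p ∈ ringZf) (a : ℤ) (i j : Fin 2) :
    antiMat p a i j ∈ ringZf := by
  fin_cases i <;> fin_cases j <;>
    simp [antiMat, hp, zero_mem, mul_mem hp (omega_zpow_mem a)]

theorem gateH_apply_mem (i j : Fin 2) : gateH i j ∈ ringZf := by
  have h := inv_sqrt_two_mem
  rw [gateH_eq]
  fin_cases i <;> fin_cases j
  exacts [h, h, h, neg_mem h]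

/-- Clifford generators have determinant an even power of ω, while det T = ω. The parity of the
determinant's exponent therefore counts T gates. -/
theorem generator_properties {g : Matrix (Fin 2) (Fin 2) ℂ}
    (hg : g ∈ ({gateX, gateY, gateZ, gateH, gateP} : Set (Matrix (Fin 2) (Fin 2) ℂ))) :
    (∀ i j, g i j ∈ ringZf) ∧ g * gᴴ = 1 ∧ ∃ c : ℤ, g.det = omega ^ (2 * c) := by
  have w4 : omega ^ (4 : ℤ) = -1 := by exact_mod_cast omega_pow_four
  have w2 : omega ^ (2 : ℤ) = Complex.I := by exact_mod_cast omega_sq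
  have h1 : (1 : ℂ) ∈ ringZf := one_mem _
  rcases hg with rfl | rfl | rfl | rfl | rfl
  · refine ⟨?_, isMonomial_gateX.mul_conjTranspose, 2, ?_⟩
    · rw [gateX_eq]; exact antiMat_apply_mem h1 _
    · norm_num [w4, gateX]
  · refine ⟨?_, isMonomial_gateY.mul_conjTranspose, 2, ?_⟩
    · rw [gateY_eq]; exact antiMat_apply_mem (mul_mem I_mem (omega_zpow_mem 4)) _
    · norm_num [w4, gateY, gateX, gateZ, Matrix.det_smul]
  · refine ⟨?_, isMonomial_gateZ.mul_conjTranspose, 2, ?_⟩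
    · rw [gateZ_eq]; exact diagMat_apply_mem h1 _
    · norm_num [w4, gateZ]
  · refine ⟨gateH_apply_mem, by rw [conjTranspose_gateH, gateH_mul_gateH], 2, ?_⟩
    have h2 := sqrt_two_mul_self
    have h0 := sqrt_two_ne_zero
    rw [gateH_eq, Matrix.det_fin_two_of, show (2 : ℤ) * 2 = 4 by norm_num, w4]
    field_simp
    linear_combination h2
  · refine ⟨?_, isMonomial_gateP.mul_conjTranspose, 1, ?_⟩
    · rw [gateP_eq]; exact diagMat_apply_mem h1 _
    · rw [gateP_eq, diagMat, Matrix.det_fin_two_of]; norm_num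

theorem CircuitWith.properties {n : ℕ} {W : Matrix (Fin 2) (Fin 2) ℂ} (hW : CircuitWith n W) :
    (∀ i j, W i j ∈ ringZf) ∧ W * Wᴴ = 1 ∧ ∃ c : ℤ, W.det = omega ^ (n + 2 * c) := by
  have hunit : ∀ A B : Matrix (Fin 2) (Fin 2) ℂ, A * Aᴴ = 1 → B * Bᴴ = 1 →
      A * B * (A * B)ᴴ = 1 := by
    intro A B hA hB
    rw [Matrix.conjTranspose_mul, Matrix.mul_assoc, ← Matrix.mul_assoc B, hB, Matrix.one_mul, hA]
  refine circuit_induction (Q := fun n W => (∀ i j, W i j ∈ ringZf) ∧ W * Wᴴ = 1 ∧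
    ∃ c : ℤ, W.det = omega ^ (n + 2 * c)) ⟨?_, by simp, 0, by simp⟩ ?_ ?_ hW
  · rw [← diagMat_one_zero]
    exact diagMat_apply_mem (one_mem _) 0
  · rintro n g hg W ⟨h1, h2, c, h3⟩
    obtain ⟨g1, g2, b, g3⟩ := generator_properties hg
    refine ⟨apply_mem_mul g1 h1, hunit _ _ g2 h2, b + c, ?_⟩
    rw [Matrix.det_mul, h3, g3, ← zpow_add₀ omega_ne_zero]
    congr 1; ring
  · rintro n W ⟨h1, h2, c, h3⟩
    refine ⟨apply_mem_mul ?_ h1, hunit _ _ isMonomial_gateT.mul_conjTranspose h2, c, ?_⟩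
    · rw [gateT_eq]; exact diagMat_apply_mem (one_mem _) 1
    · rw [Matrix.det_mul, h3, gateT_eq, diagMat, Matrix.det_fin_two_of, zpow_one, one_mul,
        one_mul, mul_zero, sub_zero, ← zpow_one_add₀ omega_ne_zero]
      congr 1; push_cast; ring

/-! ### The matrices `U[x,y,k]` -/

theorem isExact_iff {x y : ℂ} {k : ℤ} : IsExact x y k ↔
    x ∈ ringZf ∧ y ∈ ringZf ∧ x * starRingEnd ℂ x + y * starRingEnd ℂ y = 1 := by
  have hww := omega_zpow_mul_zpow_neg k
  have hc := conj_omega_zpow k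
  rw [IsExact, Matrix.mem_unitaryGroup_iff', Matrix.star_eq_conjTranspose]
  refine and_congr_right fun _ => and_congr_right fun _ => ⟨fun h => ?_, fun h => ?_⟩
  · have := congrFun (congrFun h 0) 0
    simp [U, Matrix.mul_apply, Fin.sum_univ_two] at this
    linear_combination this
  · ext i j
    fin_cases i <;> fin_cases j <;>
      simp [-map_zpow₀, -zpow_neg, hc, U, Matrix.mul_apply, Fin.sum_univ_two]
    · linear_combination h
    · ring
    · ring
    · linear_combination (omega ^ k * omega ^ (-k)) * h + hww

theorem U_apply_mem {x y : ℂ} (hx : x ∈ ringZf) (hy : y ∈ ringZf) (k : ℤ) (i j : Fin 2) :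
    U x y k i j ∈ ringZf := by
  have h := omega_zpow_mem k
  fin_cases i <;> fin_cases j
  exacts [hx, mul_mem (neg_mem (conj_mem hy)) h, hy, mul_mem (conj_mem hx) h]

/-- Write U = uW. The phase u is an entry of U W†, so it lies in the ring, and u² det W = ω^k. If k
− n were odd, ω would be a square in the ring. -/
theorem even_sub_of_phaseCircuit {x y : ℂ} {k : ℤ} {n : ℕ} (hU : IsExact x y k)
    (h : PhaseCircuit n (U x y k)) : Even (k - n) := by
  obtain ⟨hx, hy, hxy⟩ := isExact_iff.1 hU
  obtain ⟨u, -, W, hW, h⟩ := h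
  obtain ⟨h1, h2, c, h3⟩ := hW.properties
  have hu : u ∈ ringZf := by
    have e : U x y k * Wᴴ = u • 1 := by rw [h, Matrix.smul_mul, h2]
    have := apply_mem_mul (U_apply_mem hx hy k) (B := Wᴴ) (fun i j => conj_mem (h1 j i)) 0 0
    rw [e] at this
    simpa using this
  have hdet : u ^ 2 * omega ^ (n + 2 * c) = omega ^ k := by
    have := congrArg Matrix.det h
    rw [Matrix.det_smul, h3, Fintype.card_fin] at this
    rw [← this, U, Matrix.det_fin_two_of]
    linear_combination omega ^ k * hxy
  by_contra hodd
  rw [Int.not_even_iff_odd] at hodd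
  obtain ⟨l, hl⟩ := hodd
  -- With k = n + 2l + 1, the relation u² ω^(n+2c) = ω^k says (u ω^(c−l))² = ω.
  refine sq_ne_omega (mul_mem hu (omega_zpow_mem (c - l))) ?_
  have hne : omega ^ (n + 2 * l : ℤ) ≠ 0 := zpow_ne_zero _ omega_ne_zero
  apply mul_right_cancel₀ hne
  have e1 : (omega ^ (c - l)) ^ 2 * omega ^ (n + 2 * l : ℤ) = omega ^ (n + 2 * c : ℤ) := by
    rw [sq, ← zpow_add₀ omega_ne_zero, ← zpow_add₀ omega_ne_zero]
    congr 1; ring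
  rw [mul_pow, mul_assoc, e1, hdet, ← zpow_one_add₀ omega_ne_zero]
  congr 1; omega

/-- The entry is |x|² − |y|², and |x|² + |y|² = 1. It depends on x alone, which is why the T-count
can be read off from |x|². -/
theorem U_conj_gateZ_apply {x y : ℂ} {k : ℤ} (hU : IsExact x y k) :
    (U x y k * gateZ * (U x y k)ᴴ) 0 0 = ((2 * ‖x‖ ^ 2 - 1 : ℝ) : ℂ) := by
  obtain ⟨-, -, hxy⟩ := isExact_iff.1 hU
  have hww := omega_zpow_mul_zpow_neg k
  have hn : x * starRingEnd ℂ x = ((‖x‖ ^ 2 : ℝ) : ℂ) := by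
    rw [Complex.mul_conj, Complex.normSq_eq_norm_sq]
  have hc := conj_omega_zpow k
  push_cast at hn ⊢
  rw [← hn]
  simp [-map_zpow₀, -zpow_neg, hc, U, gateZ, Matrix.mul_apply, Fin.sum_univ_two]
  linear_combination -(y * starRingEnd ℂ y) * hww - hxy

theorem U_add_even (x y : ℂ) (k j : ℤ) : U x y (k + 2 * j) = U x y k * diagMat 1 (2 * j) := by
  ext i l
  fin_cases i <;> fin_cases l <;>
    simp [U, diagMat, Matrix.mul_apply, Fin.sum_univ_two, zpow_add₀ omega_ne_zero] <;> ring

theorem U_omega_zpow_mul (x y : ℂ) (k j : ℤ) :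
    U (omega ^ j * x) (omega ^ (-j) * y) k = diagMat (omega ^ j) (2 * -j) * U x y k := by
  have h : omega ^ j * omega ^ (2 * -j) = omega ^ (-j) := by
    rw [← zpow_add₀ omega_ne_zero]; congr 1; ring
  have hc := conj_omega_zpow j
  have hc' := conj_omega_zpow (-j)
  rw [neg_neg] at hc'
  ext i l
  fin_cases i <;> fin_cases l <;>
    simp [-map_zpow₀, -mul_neg, -zpow_neg, hc, hc', h, U, diagMat, Matrix.mul_apply,
      Fin.sum_univ_two] <;> ring

theorem U_omega_zpow_mul_right (x y : ℂ) (k j : ℤ) :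
    U x (omega ^ j * y) k = diagMat 1 j * U x y k * diagMat 1 (-j) := by
  have h := omega_zpow_mul_zpow_neg j
  have hc := conj_omega_zpow j
  ext i l
  fin_cases i <;> fin_cases l <;>
    simp [-map_zpow₀, -zpow_neg, hc, U, diagMat, Matrix.mul_apply, Fin.sum_univ_two]
  · ring
  · linear_combination -(starRingEnd ℂ x * omega ^ k) * h

theorem isExact_mul_mul {x y u v : ℂ} {k l : ℤ} (h : IsExact x y k) (hu : u ∈ ringZf)
    (hv : v ∈ ringZf) (hu' : ‖u‖ = 1) (hv' : ‖v‖ = 1) : IsExact (u * x) (v * y) l := by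
  obtain ⟨hx, hy, hxy⟩ := isExact_iff.1 h
  refine isExact_iff.2 ⟨mul_mem hu hx, mul_mem hv hy, ?_⟩
  have h1 := mul_conj_of_norm_eq_one hu'
  have h2 := mul_conj_of_norm_eq_one hv'
  rw [map_mul, map_mul]
  linear_combination x * starRingEnd ℂ x * h1 + y * starRingEnd ℂ y * h2 + hxy

/-! ### T-counts of ring elements -/

theorem tCountElem_le_tCountElem {x x' : ℂ} {k k' : ℤ}
    (h : ∀ y, IsExact x y k → ∃ y', IsExact x' y' k' ∧
      ∀ n, PhaseCircuit n (U x y k) → PhaseCircuit n (U x' y' k')) :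
    tCountElem k' x' ≤ tCountElem k x := by
  refine le_sInf ?_
  rintro _ ⟨y, hy, rfl⟩
  obtain ⟨y', hy', hn⟩ := h y hy
  exact (sInf_le (show tCount (U x' y' k') ∈ tCounts k' x' from ⟨y', hy', rfl⟩)).trans
    (tCount_le_tCount hn)

theorem tCountElem_add_even_le (x : ℂ) (k j : ℤ) :
    tCountElem (k + 2 * j) x ≤ tCountElem k x := by
  refine tCountElem_le_tCountElem fun y hy => ⟨y, isExact_iff.2 (isExact_iff.1 hy), ?_⟩
  intro n hn
  rw [U_add_even]
  exact hn.mul_even (even_two_mul j) ⟨1, by simp, .inl rfl⟩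

theorem tCountElem_emod_two (x : ℂ) (k : ℤ) : tCountElem k x = tCountElem (k % 2) x := by
  apply le_antisymm
  · have := tCountElem_add_even_le x (k % 2) (k / 2)
    rwa [Int.emod_add_mul_ediv] at this
  · have := tCountElem_add_even_le x k (-(k / 2))
    rwa [show k + 2 * -(k / 2) = k % 2 by omega] at this

theorem tCountElem_omega_zpow_mul_le (x : ℂ) (k j : ℤ) :
    tCountElem k (omega ^ j * x) ≤ tCountElem k x := by
  refine tCountElem_le_tCountElem fun y hy => ⟨omega ^ (-j) * y,
    isExact_mul_mul hy (omega_zpow_mem _) (omega_zpow_mem _) (norm_omega_zpow _)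
      (norm_omega_zpow _), ?_⟩
  intro n hn
  rw [U_omega_zpow_mul]
  exact hn.even_mul (even_two_mul _) ⟨_, norm_omega_zpow j, .inl rfl⟩

theorem tCountElem_omega_mul (x : ℂ) (k : ℤ) :
    tCountElem k x = tCountElem k (omega * x) := by
  apply le_antisymm
  · have := tCountElem_omega_zpow_mul_le (omega * x) k (-1)
    rwa [zpow_neg_one, inv_mul_cancel_left₀ omega_ne_zero] at this
  · simpa using tCountElem_omega_zpow_mul_le x k 1

theorem exists_of_tCountElem_lt_top {k : ℤ} {x : ℂ} (h : tCountElem k x < ⊤) :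
    ∃ (n : ℕ) (y : ℂ), tCountElem k x = n ∧ IsExact x y k ∧ PhaseCircuit n (U x y k) := by
  have hne : (tCounts k x).Nonempty := by
    by_contra hne
    rw [Set.not_nonempty_iff_eq_empty] at hne
    rw [tCountElem, hne, sInf_empty] at h
    exact lt_irrefl _ h
  obtain ⟨y, hy, hy'⟩ := csInf_mem hne
  change tCountElem k x = _ at hy'
  obtain ⟨n, hn⟩ := ENat.ne_top_iff_exists.1 h.ne
  refine ⟨n, y, hn.symm, hy, phaseCircuit_of_tCount_eq ?_⟩
  rw [← hy', hn]

theorem tCountElem_le_of_core {x y : ℂ} {k : ℤ} {u : ℂ} {m : ℕ} {a b : ℤ}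
    {d V d' : Matrix (Fin 2) (Fin 2) ℂ} (hU : IsExact x y k) (hu : ‖u‖ = 1) (hV : Core m V)
    (hd : IsMonomial a d) (hd' : IsMonomial b d') (h : U x y k = u • (d * V * d')) :
    tCountElem k x ≤ (m + 1 : ℕ) := by
  -- Conjugating by diag(1, ω^j) keeps x. The exponent j is chosen to cancel that of d', and the
  -- compensating diagonal factor goes to the left of the core.
  have key : ∀ j : ℤ, IsMonomial 0 (d' * diagMat 1 (-j)) → tCountElem k x ≤ (m + 1 : ℕ) := by
    intro j hj
    have hex : IsExact (1 * x) (omega ^ j * y) k :=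
      isExact_mul_mul hU (one_mem _) (omega_zpow_mem j) norm_one (norm_omega_zpow j)
    rw [one_mul] at hex
    have hmem : tCount (U x (omega ^ j * y) k) ∈ tCounts k x := ⟨_, hex, rfl⟩
    refine (sInf_le hmem).trans ?_
    have hL : IsMonomial j (diagMat u j) := ⟨u, hu, .inl rfl⟩
    obtain ⟨f, hf, -⟩ := hL.mul hd
    have e : U x (omega ^ j * y) k = diagMat u j * d * (V * (d' * diagMat 1 (-j))) := by
      rw [U_omega_zpow_mul_right, h, Matrix.mul_smul, Matrix.smul_mul,
        show diagMat u j = u • diagMat 1 j by rw [smul_diagMat, mul_one]]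
      simp only [Matrix.smul_mul, Matrix.mul_assoc]
    rw [e]
    exact (hV.phaseCircuit.mul_even (by decide) hj).tCount_monomial_mul_le hf
  -- Exponents add behind a diagonal d' and subtract behind an antidiagonal one, hence j = b and j =
  -- −b.
  obtain ⟨p, hp, rfl | rfl⟩ := hd'
  · refine key b ⟨p, hp, .inl ?_⟩
    rw [diagMat_mul_diagMat]; simp
  · refine key (-b) ⟨p * 1 * omega ^ (- -b), by simp [hp, norm_omega], .inr ?_⟩
    rw [antiMat_mul_diagMat, sub_neg_eq_add, add_neg_cancel]

/-! ### The smallest denominator exponent and the T-count formula -/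

theorem isSde_of_hasResidue {m : ℕ} {w : ℝ} (hm : m ≠ 0)
    (h : HasResidue 1 (Real.sqrt 2 ^ m * (2 * w - 1))) : IsSde w (m + 2) := by
  have hr : (0 : ℝ) < Real.sqrt 2 := by positivity
  have hsq : Real.sqrt 2 ^ 2 = 2 := Real.sq_sqrt (by norm_num)
  -- √2^(m+2) w = √2^m (2w − 1) + √2^m, and the last term vanishes modulo √2 because m ≠ 0.
  have hres : HasResidue 1 (Real.sqrt 2 ^ (m + 2) * w) := by
    have h1 := h.add ((hasResidue_intCast 1).sqrt_two_pow_mul hm)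
    rw [add_zero] at h1
    convert h1 using 1
    rw [pow_add, hsq]; push_cast; ring
  constructor
  · obtain ⟨p, q, hpq, -⟩ := hres
    refine ⟨p, q, ?_⟩
    rw [← hpq]
    have : Real.sqrt 2 ^ (m + 2 : ℤ) = Real.sqrt 2 ^ (m + 2) := by norm_cast
    rw [this]
    field_simp
  · rintro l ⟨p, q, hw⟩
    by_contra! hlt
    obtain ⟨j, hj⟩ := Int.eq_ofNat_of_zero_le (show 0 ≤ (m + 2 : ℤ) - l by omega)
    have hj0 : j ≠ 0 := by omega
    -- A smaller exponent l, possibly negative, would leave a positive power of √2 and so residue 0.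
    have e : Real.sqrt 2 ^ (m + 2) * w = Real.sqrt 2 ^ j * (p + Real.sqrt 2 * q) := by
      have e1 : Real.sqrt 2 ^ (m + 2) = Real.sqrt 2 ^ j * Real.sqrt 2 ^ l := by
        rw [← zpow_natCast, ← zpow_natCast, ← zpow_add₀ hr.ne']
        congr 1; push_cast; omega
      rw [hw, e1]
      field_simp
    have h0 : HasResidue 0 (Real.sqrt 2 ^ (m + 2) * w) := by
      rw [e]
      exact HasResidue.sqrt_two_pow_mul (e := p) ⟨p, q, rfl, rfl⟩ hj0
    exact absurd (hres.unique h0) (by decide)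

theorem tCountElem_eq_of_four_le {x : ℂ} {k : ℤ} (h4 : 4 ≤ tCountElem k x)
    (htop : tCountElem k x < ⊤) : ∃ (n : ℕ) (s : ℤ), tCountElem k x = (n : ℕ∞) ∧
      IsSde (‖x‖ ^ 2) s ∧ (n : ℤ) = s - 2 + (s + k) % 2 := by
  obtain ⟨n, y, hn, hy, hU⟩ := exists_of_tCountElem_lt_top htop
  have hpar := even_sub_of_phaseCircuit hy hU
  have hz := U_conj_gateZ_apply hy
  obtain ⟨u, hu, W, hW, h⟩ := hU
  have hWz : (W * gateZ * Wᴴ) 0 0 = ((2 * ‖x‖ ^ 2 - 1 : ℝ) : ℂ) := by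
    rw [← hz, h, Matrix.conjTranspose_smul, Matrix.smul_mul, Matrix.smul_mul, Matrix.mul_smul,
      smul_smul, show u * star u = 1 from mul_conj_of_norm_eq_one hu, one_smul]
  have h4n : 4 ≤ n := by rw [hn] at h4; exact_mod_cast h4
  rcases hW.hasNormalForm with ⟨a, ha⟩ | ⟨m, a, b, d, V, d', hV, hd, hd', rfl⟩
  · exfalso
    have hle : tCountElem k x ≤ (0 + 1 : ℕ) := by
      refine (sInf_le (show tCount (U x y k) ∈ tCounts k x from ⟨y, hy, rfl⟩)).trans ?_
      refine (tCount_le_tCount (V := W * 1) ?_).trans (phaseCircuit_one.tCount_monomial_mul_le ha)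
      rintro l ⟨v, hv, W', hW', e⟩
      refine ⟨u * v, by simp [hu, hv], W', hW', ?_⟩
      rw [h, ← smul_smul, ← e, Matrix.mul_one]
    rw [hn] at hle
    have : n ≤ 0 + 1 := by exact_mod_cast hle
    omega
  · have hle : n ≤ m + 1 := by
      have := tCountElem_le_of_core hy hu hV hd hd' h
      rw [hn] at this
      exact_mod_cast this
    have hm : m ≠ 0 := by omega
    obtain ⟨e, he, -, he2⟩ := hV.exists_hasBlochVec
    have hres := he.residue_of_monomial_mul hd hd' hWz
    rw [he2 hm] at hres
    have hge : m ≤ n := by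
      by_contra! hlt
      obtain ⟨f, hf⟩ := hW.hasBlochVec
      -- With n < m T gates, √2^n (2|x|² − 1) already lies in ℤ[√2], so the further factor √2^(m−n)
      -- forces residue 0 instead of 1.
      have h0 := (hf.apply_zero_zero hWz).sqrt_two_pow_mul (n := m - n) (by omega)
      rw [← mul_assoc, ← pow_add, show m - n + n = m by omega] at h0
      exact absurd (hres.unique h0) (by decide)
    -- With s = m + 2, the bounds m ≤ n ≤ m + 1 and n ≡ k mod 2 give n − m = (s + k) mod 2.
    refine ⟨n, m + 2, hn, isSde_of_hasResidue hm hres, ?_⟩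
    obtain ⟨l, hl⟩ := hpar
    omega

end CliffordT

theorem mainTheorem2 :
    (∀ (x y : ℂ) (k : ℤ), CliffordT.IsMinimal x y k →
      CliffordT.tCount (CliffordT.U x y k) = CliffordT.tCountElem k x) ∧
    (∀ x ∈ CliffordT.ringZf, ∀ k : ℤ,
      CliffordT.tCountElem k x = CliffordT.tCountElem (k % 2) x) ∧
    (∀ x ∈ CliffordT.ringZf, ∀ k : ℤ,
      CliffordT.tCountElem k x = CliffordT.tCountElem k (CliffordT.omega * x)) ∧
    (∀ x ∈ CliffordT.ringZf, ∀ k : ℤ,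
      4 ≤ CliffordT.tCountElem k x → CliffordT.tCountElem k x < ⊤ →
      ∃ (n : ℕ) (s : ℤ), CliffordT.tCountElem k x = (n : ℕ∞) ∧
        CliffordT.IsSde (‖x‖ ^ 2) s ∧ (n : ℤ) = s - 2 + (s + k) % 2) :=
  ⟨fun _ _ _ h => h.2.csInf_eq.symm,
    fun x _ k => CliffordT.tCountElem_emod_two x k,
    fun x _ k => CliffordT.tCountElem_omega_mul x k,
    fun _ _ _ h4 htop => CliffordT.tCountElem_eq_of_four_le h4 htop⟩
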